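/- Let $n,m\ge 0$, let the base be $M=\mathbb{R}^n$ with coordinates $x^\mu$, and consider $m$ real fields $\phi^i$. Let $J^k$ be the $k$-th jet bundle, with coordinates $x^\mu$ and $\phi^i_\alpha$ for multi-indices $\alpha\in\mathbb{N}^n$ with $|\alpha|\le k$. A local function is a smooth function $f$ on $J^k$ for some $k$; it has no field-independent part if $f[x,0]=0$ for all $x$. For a smooth $\phi:\mathbb{R}^n\to\mathbb{R}^m$ of compact support, let $f|_\phi(x)$ be $f$ evaluated at $x$ and at the jet coordinates $\phi^i_\alpha=\partial^\alpha\phi^i(x)$, and put $F[f,\phi]=\int_{\mathbb{R}^n}f|_\phi\,d^nx$. The total derivatives are $\partial_\nu=\frac{\partial}{\partial x^\nu}+\sum_{i,\alpha}\phi^i_{\alpha+e_\nu}\frac{\partial}{\partial\phi^i_\alpha}$ (with $e_\nu$ the $\nu$-th unit multi-index), and the Euler--Lagrange derivatives are $\frac{\delta f}{\delta\phi^i}=\sum_\alpha(-1)^{|\alpha|}\partial_\alpha\frac{\partial f}{\partial\phi^i_\alpha}$, where $\partial_\alpha$ denotes the iterated total derivative. Let $\tilde f,\tilde g$ be local functions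 with no field-independent part. Then the following are equivalent: (i) $F[\tilde f,\phi]=F[\tilde g,\phi]$ for all smooth compactly supported $\phi:\mathbb{R}^n\to\mathbb{R}^m$; (ii) there are local functions $\tilde j^\mu$ with no field-independent part such that $\tilde f=\tilde g+\sum_\mu\partial_\mu\tilde j^\mu$; (iii) $\frac{\delta}{\delta\phi^i}(\tilde f-\tilde g)=0$ for all $i$. -/

import Mathlib

open scoped ContDiff

namespace LocalFunctionals

/-- Multi-indices in `n` base directions: `α μ` is the number of times the index `μ` occurs in the
symmetric multi-index `(μ₁ … μ_l)`. -/
abbrev MultiIndex (n : ℕ) : Type := Fin n → ℕ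

/-- The length `|α|` of a multi-index. -/
def MultiIndex.len {n : ℕ} (α : MultiIndex n) : ℕ := ∑ μ, α μ

/-- Multi-indices of length at most `k`. -/
abbrev MultiIndexLE (n k : ℕ) : Type := {α : MultiIndex n // α.len ≤ k}

instance (n k : ℕ) : Finite (MultiIndexLE n k) := by
  refine Set.Finite.subset (Set.finite_Iic (fun _ : Fin n => k)) ?_
  intro α hα μ
  exact (Finset.single_le_sum (f := α) (fun _ _ => Nat.zero_le _) (Finset.mem_univ μ)).trans hα

noncomputable instance (n k : ℕ) : Fintype (MultiIndexLE n k) := Fintype.ofFinite _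

/-- The `k`-th jet bundle over `ℝⁿ` for `m` real fields, with coordinates `x^μ` and
`φ^i_α`, `|α| ≤ k`. -/
abbrev JetBundle (n m k : ℕ) : Type := (Fin n → ℝ) × (Fin m × MultiIndexLE n k → ℝ)

/-- The full set of jet coordinates `x^μ`, `φ^i_α` of all orders. Functions on the finite jet
bundles are regarded as functions of these coordinates. -/
abbrev Jet (n m : ℕ) : Type := (Fin n → ℝ) × (Fin m × MultiIndex n → ℝ)

/-- Forget the coordinates `φ^i_α` with `|α| > k`. -/
def Jet.truncate {n m : ℕ} (k : ℕ) (p : Jet n m) : JetBundle n m k :=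
  (p.1, fun a => p.2 (a.1, a.2.1))

/-- `f` is a local function: a smooth function on the `k`-th jet bundle for some `k`. -/
def IsLocal {n m : ℕ} (f : Jet n m → ℝ) : Prop :=
  ∃ (k : ℕ) (g : JetBundle n m k → ℝ), ContDiff ℝ ∞ g ∧ ∀ p, f p = g (p.truncate k)

/-- `f` has no field-independent part: `f[x, 0] = 0` for all `x`. -/
def NoFieldIndependentPart {n m : ℕ} (f : Jet n m → ℝ) : Prop :=
  ∀ x : Fin n → ℝ, f (x, 0) = 0

/-- `D₀^{α₀} D₁^{α₁} ⋯ h`, for a family of operators `D μ` on functions. -/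
def multiOp {n : ℕ} {X : Type} (D : Fin n → (X → ℝ) → (X → ℝ)) (α : MultiIndex n)
    (h : X → ℝ) : X → ℝ :=
  (List.finRange n).foldr (fun μ g => (D μ)^[α μ] g) h

/-- The partial derivative `∂h/∂x^μ` of a function on `ℝⁿ`. -/
noncomputable def basePartial {n : ℕ} (μ : Fin n) (h : (Fin n → ℝ) → ℝ) : (Fin n → ℝ) → ℝ :=
  fun x => lineDeriv ℝ h x (Pi.single μ 1)

/-- The partial derivative `∂f/∂x^μ` with respect to the explicit dependence on `x^μ`. -/
noncomputable def partialX {n m : ℕ} (μ : Fin n) (f : Jet n m → ℝ) : Jet n m → ℝ :=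
  fun p => lineDeriv ℝ f p (Pi.single μ 1, 0)

/-- The partial derivative `∂f/∂φ^i_α` with respect to one jet coordinate. -/
noncomputable def partialJet {n m : ℕ} (i : Fin m) (α : MultiIndex n) (f : Jet n m → ℝ) :
    Jet n m → ℝ :=
  fun p => lineDeriv ℝ f p (0, Pi.single (i, α) 1)

/-- The total derivative `∂_ν f = ∂f/∂x^ν + ∑_{i,α} φ^i_{αν} ∂f/∂φ^i_α`. On a local function only
finitely many terms of the sum are nonzero. -/
noncomputable def totalDeriv {n m : ℕ} (ν : Fin n) (f : Jet n m → ℝ) : Jet n m → ℝ :=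
  fun p => partialX ν f p +
    ∑ᶠ a : Fin m × MultiIndex n, p.2 (a.1, a.2 + Pi.single ν 1) * partialJet a.1 a.2 f p

/-- The Euler–Lagrange derivative `δf/δφ^i = ∑_α (-1)^{|α|} ∂_α (∂f/∂φ^i_α)`. The sum over
multi-indices `α` of plain partial derivatives is the sum over all index tuples of symmetrized
derivatives; on a local function only finitely many terms are nonzero. -/
noncomputable def eulerLagrange {n m : ℕ} (i : Fin m) (f : Jet n m → ℝ) : Jet n m → ℝ :=
  fun p => ∑ᶠ α : MultiIndex n, (-1 : ℝ) ^ α.len * multiOp totalDeriv α (partialJet i α f) p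

/-- The section of the jet bundle given by a field configuration `φ` and its partial
derivatives. -/
noncomputable def prolong {n m : ℕ} (φ : (Fin n → ℝ) → (Fin m → ℝ)) (x : Fin n → ℝ) : Jet n m :=
  (x, fun a => multiOp basePartial a.2 (fun y => φ y a.1) x)

/-- The local functional `F[f, φ] = ∫ dⁿx f(x, φ(x), ∂φ(x), …)`. If `f` is local without
field-independent part and `φ` is smooth with compact support, the integrand is continuous with
compact support. -/
noncomputable def localFunctional {n m : ℕ} (f : Jet n m → ℝ) (φ : (Fin n → ℝ) → (Fin m → ℝ)) :
    ℝ :=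
  ∫ x : Fin n → ℝ, f (prolong φ x)

/-- `f = g + ∂_μ j^μ` for some local functions `j^μ` without field-independent part. -/
def DifferByTotalDivergence {n m : ℕ} (f g : Jet n m → ℝ) : Prop :=
  ∃ j : Fin n → Jet n m → ℝ,
    (∀ μ, IsLocal (j μ) ∧ NoFieldIndependentPart (j μ)) ∧
      ∀ p, f p = g p + ∑ μ, totalDeriv μ (j μ) p

end LocalFunctionals

/-! The implications run in a cycle (i) ⇒ (iii) ⇒ (ii) ⇒ (i); write h = f - g.

(i) ⇒ (iii). The derivative of F[h, φ + sψ] at s = 0 vanishes (`integral_variation_eq_zero`).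
Integrating by parts and applying the fundamental lemma of the calculus of variations, δh/δφ^i
vanishes on the prolongation of every compactly supported φ. Such prolongations attain every finite
jet (`exists_prolong_truncate_eq`), so δh/δφ^i vanishes identically.

(iii) ⇒ (ii). Since h[x, 0] = 0, integrating d/dt h[x, tφ] over 0 ≤ t ≤ 1 gives h = ∑ φ^i_α
A(∂h/∂φ^i_α), where A averages over t (`fiberAverage`). Modulo total divergences, each φ^i_α u
equals (-1)^|α| φ^i ∂_α u (`coordMulClass_add`), and the discarded currents contain a factor φ^i_γ,
so they vanish at zero field. As A commutes with total derivatives (`totalDeriv_fiberAverage`), what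
remains is ∑ φ^i A(δh/δφ^i) = 0.

(ii) ⇒ (i). On a prolongation, total derivatives become partial derivatives
(`totalDeriv_comp_prolong`). The currents become compactly supported functions, so their divergence
integrates to zero. -/

namespace LocalFunctionals

open MeasureTheory Topology

/-! ### Smooth dependence of integrals on parameters -/

section ParametricIntegral

variable {E T : Type} [NormedAddCommGroup E] [NormedSpace ℝ E] [ProperSpace E]
  [NormedAddCommGroup T] [NormedSpace ℝ T] [MeasurableSpace T] [BorelSpace T]
  [SecondCountableTopology T]

/-- The derivative in the parameter is continuous, hence bounded on a closed ball times `K`, which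
is compact; this constant is the dominating function. -/
theorem hasFDerivAt_setIntegral_of_contDiff {F : Type} [NormedAddCommGroup F] [NormedSpace ℝ F]
    {G : E × T → F} (hG : ContDiff ℝ 1 G) {K : Set T} (hK : IsCompact K) (μ : Measure T)
    [IsFiniteMeasureOnCompacts μ] (x : E) :
    HasFDerivAt (fun x => ∫ t in K, G (x, t) ∂μ)
      (∫ t in K, (fderiv ℝ G (x, t)).comp (ContinuousLinearMap.inl ℝ E T) ∂μ) x := by
  have hc : Continuous fun z : E × T =>
      (fderiv ℝ G z).comp (ContinuousLinearMap.inl ℝ E T) :=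
    (hG.continuous_fderiv one_ne_zero).clm_comp continuous_const
  obtain ⟨C, hC⟩ := ((isCompact_closedBall x 1).prod hK).exists_bound_of_continuousOn
    hc.continuousOn
  have hmeas : ∀ y, Continuous fun t => G (y, t) := fun y => by
    have := hG.continuous; fun_prop
  have : IsFiniteMeasure (μ.restrict K) := ⟨by simpa using hK.measure_lt_top⟩
  refine hasFDerivAt_integral_of_dominated_of_fderiv_le (bound := fun _ => C)
    (F := fun x t => G (x, t))
    (F' := fun x t => (fderiv ℝ G (x, t)).comp (ContinuousLinearMap.inl ℝ E T))
    (Metric.closedBall_mem_nhds x one_pos) ?_ ?_ ?_ ?_ ?_ ?_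
  · exact Filter.Eventually.of_forall fun y => (hmeas y).aestronglyMeasurable
  · exact (hmeas x).continuousOn.integrableOn_compact hK
  · have : Continuous fun t : T => (fderiv ℝ G (x, t)).comp (ContinuousLinearMap.inl ℝ E T) :=
      hc.comp (by fun_prop : Continuous fun t : T => (x, t))
    exact this.aestronglyMeasurable
  · filter_upwards [ae_restrict_mem hK.measurableSet] with t ht y hy
    exact hC (y, t) ⟨hy, ht⟩
  · exact integrable_const C
  · refine Filter.Eventually.of_forall fun t y _ => ?_
    exact ((hG.differentiable one_ne_zero) (y, t)).hasFDerivAt.comp y (hasFDerivAt_prodMk_left y t)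

/-- The derivative is again an integral of this kind, with an operator-valued integrand; the
induction on `N` therefore lets the target `F` vary. -/
theorem contDiff_setIntegral {K : Set T} (hK : IsCompact K) (μ : Measure T)
    [IsFiniteMeasureOnCompacts μ] (N : ℕ) {F : Type} [NormedAddCommGroup F] [NormedSpace ℝ F]
    {G : E × T → F} (hG : ContDiff ℝ ∞ G) :
    ContDiff ℝ N (fun x => ∫ t in K, G (x, t) ∂μ) := by
  have key : ∀ {F : Type} [NormedAddCommGroup F] [NormedSpace ℝ F] {G : E × T → F},
      ContDiff ℝ ∞ G → ∀ x, HasFDerivAt (fun x => ∫ t in K, G (x, t) ∂μ)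
      (∫ t in K, (fderiv ℝ G (x, t)).comp (ContinuousLinearMap.inl ℝ E T) ∂μ) x :=
    fun hG x => hasFDerivAt_setIntegral_of_contDiff (hG.of_le (by exact_mod_cast le_top)) hK μ x
  induction N generalizing F G with
  | zero =>
    rw [Nat.cast_zero, contDiff_zero]
    exact continuous_iff_continuousAt.2 fun x => (key hG x).continuousAt
  | succ N ih =>
    rw [Nat.cast_succ, contDiff_succ_iff_fderiv]
    refine ⟨fun x => (key hG x).differentiableAt, by simp, ?_⟩
    have : fderiv ℝ (fun x => ∫ t in K, G (x, t) ∂μ) =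
      fun x => ∫ t in K, (fderiv ℝ G (x, t)).comp (ContinuousLinearMap.inl ℝ E T) ∂μ :=
      funext fun x => (key hG x).fderiv
    rw [this]
    exact ih (G := fun z => (fderiv ℝ G z).comp (ContinuousLinearMap.inl ℝ E T))
      ((hG.fderiv_right (m := ∞) (by simp)).clm_comp contDiff_const)

end ParametricIntegral

/-! ### Operators iterated along a multi-index -/

section MultiOp

variable {n : ℕ} {X Y : Type}

theorem iterate_invariant {D : (X → ℝ) → (X → ℝ)} {C : (X → ℝ) → Prop}
    (hD : ∀ h, C h → C (D h)) (r : ℕ) {h : X → ℝ} (hh : C h) : C (D^[r] h) := by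
  induction r with
  | zero => exact hh
  | succ r ih => rw [Function.iterate_succ_apply']; exact hD _ ih

theorem multiOp_invariant {D : Fin n → (X → ℝ) → (X → ℝ)} {C : (X → ℝ) → Prop}
    (hD : ∀ μ h, C h → C (D μ h)) (α : MultiIndex n) {h : X → ℝ} (hh : C h) :
    C (multiOp D α h) := by
  unfold multiOp
  induction List.finRange n with
  | nil => exact hh
  | cons μ l ih => exact iterate_invariant (hD μ) _ ih

theorem multiOp_zero (D : Fin n → (X → ℝ) → (X → ℝ)) (h : X → ℝ) : multiOp D 0 h = h := by
  simp [multiOp]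

/-- Serves both restriction to a prolongation and averaging over the fibre. The class `C` is needed
because the intertwining holds only for local functions. -/
theorem multiOp_intertwine {D : Fin n → (X → ℝ) → (X → ℝ)} {D' : Fin n → (Y → ℝ) → (Y → ℝ)}
    {C : (X → ℝ) → Prop} (hD : ∀ μ h, C h → C (D μ h)) {Φ : (X → ℝ) → (Y → ℝ)}
    (hΦ : ∀ μ h, C h → Φ (D μ h) = D' μ (Φ h)) (α : MultiIndex n) {h : X → ℝ} (hh : C h) :
    Φ (multiOp D α h) = multiOp D' α (Φ h) := by
  have hit : ∀ μ r h, C h → Φ ((D μ)^[r] h) = (D' μ)^[r] (Φ h) := by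
    intro μ r h hh
    induction r with
    | zero => rfl
    | succ r ih =>
      rw [Function.iterate_succ_apply', Function.iterate_succ_apply', ← ih,
        hΦ _ _ (iterate_invariant (hD μ) r hh)]
  unfold multiOp
  suffices H : ∀ l : List (Fin n), C (l.foldr (fun μ g => (D μ)^[α μ] g) h) ∧
      Φ (l.foldr (fun μ g => (D μ)^[α μ] g) h) = l.foldr (fun μ g => (D' μ)^[α μ] g) (Φ h) from
    (H _).2
  intro l
  induction l with
  | nil => exact ⟨hh, rfl⟩
  | cons μ l ih =>
    refine ⟨iterate_invariant (hD μ) _ ih.1, ?_⟩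
    simp only [List.foldr_cons]
    rw [hit _ _ _ ih.1, ih.2]

/-- Iterated integration by parts, for an abstract pairing `T` of a multi-index with functions. -/
theorem multiOp_transfer {M : Type} [AddCommGroup M] [Module ℝ M]
    {D : Fin n → (X → ℝ) → (X → ℝ)} {C : (X → ℝ) → Prop} (hD : ∀ μ h, C h → C (D μ h))
    {T : MultiIndex n → (X → ℝ) → M}
    (hT : ∀ γ μ h, C h → T (γ + Pi.single μ 1) h = -T γ (D μ h))
    (γ α : MultiIndex n) {h : X → ℝ} (hh : C h) :
    T (γ + α) h = (-1 : ℝ) ^ α.len • T γ (multiOp D α h) := by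
  have hit : ∀ μ r γ h, C h →
      T (γ + Pi.single μ r) h = (-1 : ℝ) ^ r • T γ ((D μ)^[r] h) := by
    intro μ r
    induction r with
    | zero => intro γ h _; simp
    | succ r ih =>
      intro γ h hh
      rw [Pi.single_add, ← add_assoc, hT _ _ _ hh, ih _ _ (hD _ _ hh),
        Function.iterate_succ_apply, pow_succ]
      simp
  -- `γ` stays arbitrary because each list entry contributes its share of `α` to it.
  have H : ∀ (l : List (Fin n)) γ, C (l.foldr (fun μ g => (D μ)^[α μ] g) h) ∧
      T (γ + (l.map fun μ => Pi.single μ (α μ)).sum) h =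
        (-1 : ℝ) ^ (l.map α).sum • T γ (l.foldr (fun μ g => (D μ)^[α μ] g) h) := by
    intro l
    induction l with
    | nil => intro γ; exact ⟨hh, by simp⟩
    | cons μ l ih =>
      intro γ
      refine ⟨iterate_invariant (hD μ) _ (ih γ).1, ?_⟩
      simp only [List.foldr_cons, List.map_cons, List.sum_cons]
      rw [← add_assoc, (ih _).2, hit _ _ _ _ (ih γ).1, smul_smul, ← pow_add, add_comm]
  have h1 := (H (List.finRange n) γ).2
  have h2 : ((List.finRange n).map fun μ => (Pi.single μ (α μ) : MultiIndex n)).sum = α := by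
    rw [← List.ofFn_eq_map, List.sum_ofFn]
    exact Finset.univ_sum_single α
  have h3 : ((List.finRange n).map α).sum = α.len := by
    rw [← List.ofFn_eq_map, List.sum_ofFn, MultiIndex.len]
  rw [h2, h3] at h1
  exact h1

/-- The operators are applied in a fixed order, so the extra `D ν` must be commuted inwards to its
own slot. -/
theorem apply_multiOp {D : Fin n → (X → ℝ) → (X → ℝ)} {C : (X → ℝ) → Prop}
    (hD : ∀ μ h, C h → C (D μ h)) (hcomm : ∀ μ ν h, C h → D μ (D ν h) = D ν (D μ h))
    (ν : Fin n) (α : MultiIndex n) {h : X → ℝ} (hh : C h) :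
    D ν (multiOp D α h) = multiOp D (α + Pi.single ν 1) h := by
  have hit : ∀ μ r h, C h → D ν ((D μ)^[r] h) = (D μ)^[r] (D ν h) := by
    intro μ r h hh
    induction r with
    | zero => rfl
    | succ r ih =>
      rw [Function.iterate_succ_apply', Function.iterate_succ_apply', ← ih,
        hcomm _ _ _ (iterate_invariant (hD μ) r hh)]
  have hC : ∀ l : List (Fin n), C (l.foldr (fun μ g => (D μ)^[α μ] g) h) := by
    intro l
    induction l with
    | nil => exact hh
    | cons μ l ih => exact iterate_invariant (hD μ) _ ih
  -- The exponent changes only at the entry `ν`, which occurs at most once.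
  have H : ∀ l : List (Fin n), l.Nodup →
      (ν ∈ l → l.foldr (fun μ g => (D μ)^[(α + Pi.single ν 1 : MultiIndex n) μ] g) h =
        D ν (l.foldr (fun μ g => (D μ)^[α μ] g) h)) ∧
      (ν ∉ l → l.foldr (fun μ g => (D μ)^[(α + Pi.single ν 1 : MultiIndex n) μ] g) h =
        l.foldr (fun μ g => (D μ)^[α μ] g) h) := by
    intro l
    induction l with
    | nil => simp
    | cons μ l ih =>
      intro hnd
      obtain ⟨hμ, hl⟩ := List.nodup_cons.1 hnd
      simp only [List.foldr_cons]
      by_cases hμν : ν = μ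
      · subst hμν
        refine ⟨fun _ => ?_, fun hn => absurd List.mem_cons_self hn⟩
        rw [(ih hl).2 hμ, Pi.add_apply, Pi.single_eq_same, Function.iterate_succ_apply']
      · have hz : (α + Pi.single ν 1 : MultiIndex n) μ = α μ := by
          simp [Pi.single_eq_of_ne (Ne.symm hμν)]
        rw [hz]
        refine ⟨fun hm => ?_, fun hm => ?_⟩
        · rw [(ih hl).1 ((List.mem_cons.1 hm).resolve_left hμν), hit _ _ _ (hC l)]
        · rw [(ih hl).2 fun h => hm (List.mem_cons_of_mem _ h)]
  exact ((H _ (List.nodup_finRange n)).1 (List.mem_finRange ν)).symm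

end MultiOp

/-! ### Partial derivatives and integration by parts on the base -/

section Base

variable {n m : ℕ}

theorem basePartial_eq_fderiv {u : (Fin n → ℝ) → ℝ} (hu : ContDiff ℝ ∞ u) (μ : Fin n) :
    basePartial μ u = fun x => fderiv ℝ u x (Pi.single μ 1) :=
  funext fun x => ((hu.differentiable (by simp)) x).lineDeriv_eq_fderiv

theorem contDiff_basePartial (μ : Fin n) (u : (Fin n → ℝ) → ℝ) (hu : ContDiff ℝ ∞ u) :
    ContDiff ℝ ∞ (basePartial μ u) := by
  rw [basePartial_eq_fderiv hu]
  exact (hu.fderiv_right (m := ∞) (by simp)).clm_apply contDiff_const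

theorem contDiff_multiOp_basePartial (α : MultiIndex n) {u : (Fin n → ℝ) → ℝ}
    (hu : ContDiff ℝ ∞ u) : ContDiff ℝ ∞ (multiOp basePartial α u) :=
  multiOp_invariant contDiff_basePartial α hu

theorem basePartial_comm (μ ν : Fin n) (u : (Fin n → ℝ) → ℝ) (hu : ContDiff ℝ ∞ u) :
    basePartial μ (basePartial ν u) = basePartial ν (basePartial μ u) := by
  have hd : Differentiable ℝ (fderiv ℝ u) :=
    (hu.fderiv_right (m := ∞) (by simp)).differentiable (by simp)
  have key : ∀ (μ ν : Fin n) x, basePartial μ (basePartial ν u) x =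
      fderiv ℝ (fderiv ℝ u) x (Pi.single μ 1) (Pi.single ν 1) := by
    intro μ ν x
    rw [basePartial_eq_fderiv (contDiff_basePartial ν u hu), basePartial_eq_fderiv hu]
    simp only
    rw [fderiv_clm_apply (hd x) (by fun_prop)]
    simp
  funext x
  rw [key, key]
  exact ((contDiff_infty.1 hu 2).contDiffAt.isSymmSndFDerivAt (by simp)) _ _

theorem basePartial_multiOp (ν : Fin n) (α : MultiIndex n) {u : (Fin n → ℝ) → ℝ}
    (hu : ContDiff ℝ ∞ u) :
    basePartial ν (multiOp basePartial α u) = multiOp basePartial (α + Pi.single ν 1) u :=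
  apply_multiOp contDiff_basePartial basePartial_comm ν α hu

theorem multiOp_basePartial_eq_zero {U : Set (Fin n → ℝ)} (hU : IsOpen U)
    {u : (Fin n → ℝ) → ℝ} (hu : ∀ x ∈ U, u x = 0) (α : MultiIndex n) :
    ∀ x ∈ U, multiOp basePartial α u x = 0 := by
  refine multiOp_invariant (C := fun v => ∀ x ∈ U, v x = 0) ?_ α hu
  intro μ v hv x hx
  have : v =ᶠ[𝓝 x] fun _ => 0 := by filter_upwards [hU.mem_nhds hx] with y hy using hv y hy
  rw [basePartial, this.lineDeriv_eq]
  simp [lineDeriv]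

theorem hasCompactSupport_multiOp_basePartial (α : MultiIndex n) {u : (Fin n → ℝ) → ℝ}
    (hu : HasCompactSupport u) : HasCompactSupport (multiOp basePartial α u) := by
  refine HasCompactSupport.intro hu fun x hx => ?_
  exact multiOp_basePartial_eq_zero (isClosed_tsupport u).isOpen_compl
    (fun y hy => image_eq_zero_of_notMem_tsupport hy) α x hx

theorem integral_mul_basePartial {u v : (Fin n → ℝ) → ℝ} (hu : ContDiff ℝ ∞ u)
    (hv : ContDiff ℝ ∞ v) (hc : HasCompactSupport v) (μ : Fin n) :
    ∫ x, basePartial μ v x * u x = -∫ x, v x * basePartial μ u x := by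
  have hv' : HasCompactSupport (basePartial μ v) := by
    have := hasCompactSupport_multiOp_basePartial (Pi.single μ 1) hc
    rwa [← zero_add (Pi.single μ 1), ← basePartial_multiOp μ 0 hv, multiOp_zero] at this
  have h1 : Integrable (fun x => basePartial μ v x * u x) :=
    ((contDiff_basePartial μ v hv).continuous.mul hu.continuous).integrable_of_hasCompactSupport
      hv'.mul_right
  have h2 : Integrable (fun x => v x * basePartial μ u x) :=
    (hv.continuous.mul (contDiff_basePartial μ u hu).continuous).integrable_of_hasCompactSupport
      hc.mul_right
  have h3 : Integrable (fun x => v x * u x) :=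
    (hv.continuous.mul hu.continuous).integrable_of_hasCompactSupport hc.mul_right
  rw [basePartial_eq_fderiv hv] at h1 ⊢
  rw [basePartial_eq_fderiv hu] at h2 ⊢
  rw [integral_mul_fderiv_eq_neg_fderiv_mul_of_integrable h1 h2 h3
    (fun x _ => hv.differentiable (by simp) x) (fun x _ => hu.differentiable (by simp) x), neg_neg]

theorem integral_basePartial_eq_zero {v : (Fin n → ℝ) → ℝ} (hv : ContDiff ℝ ∞ v)
    (hc : HasCompactSupport v) (μ : Fin n) : ∫ x, basePartial μ v x = 0 := by
  have h := integral_mul_basePartial (u := fun _ => 1) contDiff_const hv hc μ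
  simpa [basePartial, lineDeriv] using h

theorem integral_multiOp_basePartial_mul {u v : (Fin n → ℝ) → ℝ} (hu : ContDiff ℝ ∞ u)
    (hv : ContDiff ℝ ∞ v) (hc : HasCompactSupport v) (α : MultiIndex n) :
    ∫ x, multiOp basePartial α v x * u x =
      (-1 : ℝ) ^ α.len * ∫ x, v x * multiOp basePartial α u x := by
  have h := multiOp_transfer (M := ℝ) (C := fun u => ContDiff ℝ ∞ u) contDiff_basePartial
    (T := fun γ u => ∫ x, multiOp basePartial γ v x * u x) ?_ 0 α hu
  · simpa [multiOp_zero] using h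
  · intro γ μ u hu
    rw [← basePartial_multiOp μ γ hv, integral_mul_basePartial hu
      (contDiff_multiOp_basePartial γ hv) (hasCompactSupport_multiOp_basePartial γ hc)]

end Base

/-! ### Calculus of local functions -/

section Local

variable {n m : ℕ}

/-- `f` is a smooth function of the jet coordinates of order at most `k`. -/
def IsLocalOfOrder (k : ℕ) (f : Jet n m → ℝ) : Prop :=
  ∃ g : JetBundle n m k → ℝ, ContDiff ℝ ∞ g ∧ ∀ p, f p = g (p.truncate k)

theorem IsLocalOfOrder.isLocal {k : ℕ} {f : Jet n m → ℝ} (hf : IsLocalOfOrder k f) : IsLocal f :=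
  ⟨k, hf⟩

theorem IsLocalOfOrder.mono {k l : ℕ} (h : k ≤ l) {f : Jet n m → ℝ} (hf : IsLocalOfOrder k f) :
    IsLocalOfOrder l f := by
  obtain ⟨g, hg, hfg⟩ := hf
  refine ⟨fun q => g (q.1, fun a => q.2 (a.1, ⟨a.2.1, a.2.2.trans h⟩)), hg.comp ?_, hfg⟩
  fun_prop

theorem isLocalOfOrder_const (c : ℝ) : IsLocalOfOrder 0 (fun _ : Jet n m => c) :=
  ⟨fun _ => c, contDiff_const, fun _ => rfl⟩

theorem isLocalOfOrder_coord (a : Fin m × MultiIndex n) :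
    IsLocalOfOrder a.2.len (fun p : Jet n m => p.2 a) :=
  ⟨fun q => q.2 (a.1, ⟨a.2, le_rfl⟩), by fun_prop, fun _ => rfl⟩

theorem IsLocal.const (c : ℝ) : IsLocal (fun _ : Jet n m => c) := (isLocalOfOrder_const c).isLocal

theorem IsLocal.coord (a : Fin m × MultiIndex n) : IsLocal (fun p : Jet n m => p.2 a) :=
  (isLocalOfOrder_coord a).isLocal

theorem IsLocal.add {f g : Jet n m → ℝ} (hf : IsLocal f) (hg : IsLocal g) :
    IsLocal (fun p => f p + g p) := by
  obtain ⟨k, hf⟩ := hf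
  obtain ⟨l, hg⟩ := hg
  obtain ⟨f', hf', hff⟩ := IsLocalOfOrder.mono (le_max_left k l) hf
  obtain ⟨g', hg', hgg⟩ := IsLocalOfOrder.mono (le_max_right k l) hg
  exact ⟨max k l, fun q => f' q + g' q, hf'.add hg', fun p => by simp only [hff, hgg]⟩

theorem IsLocal.mul {f g : Jet n m → ℝ} (hf : IsLocal f) (hg : IsLocal g) :
    IsLocal (fun p => f p * g p) := by
  obtain ⟨k, hf⟩ := hf
  obtain ⟨l, hg⟩ := hg
  obtain ⟨f', hf', hff⟩ := IsLocalOfOrder.mono (le_max_left k l) hf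
  obtain ⟨g', hg', hgg⟩ := IsLocalOfOrder.mono (le_max_right k l) hg
  exact ⟨max k l, fun q => f' q * g' q, hf'.mul hg', fun p => by simp only [hff, hgg]⟩

theorem IsLocal.const_mul (c : ℝ) {f : Jet n m → ℝ} (hf : IsLocal f) :
    IsLocal (fun p => c * f p) := (IsLocal.const c).mul hf

theorem IsLocal.sub {f g : Jet n m → ℝ} (hf : IsLocal f) (hg : IsLocal g) : IsLocal (f - g) := by
  have := hf.add (hg.const_mul (-1))
  convert this using 1
  funext p
  simp [sub_eq_add_neg]

theorem IsLocal.sum {ι : Type} (s : Finset ι) {f : ι → Jet n m → ℝ}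
    (hf : ∀ a ∈ s, IsLocal (f a)) : IsLocal (fun p => ∑ a ∈ s, f a p) := by
  classical
  induction s using Finset.induction_on with
  | empty => simpa using IsLocal.const 0
  | insert a s ha ih =>
    simp only [Finset.sum_insert ha]
    exact (hf a (Finset.mem_insert_self a s)).add
      (ih fun b hb => hf b (Finset.mem_insert_of_mem hb))

/-- Truncation is linear, so it carries lines to lines. Differentiation on `Jet`, which in general
has infinitely many coordinates, thus reduces to Fréchet derivatives on a finite jet bundle. -/
theorem hasLineDerivAt_comp_truncate {k : ℕ} {g : JetBundle n m k → ℝ}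
    (hg : ContDiff ℝ ∞ g) (p v : Jet n m) :
    HasLineDerivAt ℝ (fun p : Jet n m => g (p.truncate k))
      (fderiv ℝ g (p.truncate k) (v.truncate k)) p v :=
  (hg.differentiable (by simp) (p.truncate k)).hasFDerivAt.hasLineDerivAt (v.truncate k)

theorem IsLocal.hasLineDerivAt {f : Jet n m → ℝ} (hf : IsLocal f) (p v : Jet n m) :
    HasLineDerivAt ℝ f (lineDeriv ℝ f p v) p v := by
  obtain ⟨k, g, hg, hfg⟩ := hf
  obtain rfl : f = fun p => g (p.truncate k) := funext hfg
  exact (hasLineDerivAt_comp_truncate hg p v).lineDifferentiableAt.hasLineDerivAt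

theorem lineDeriv_comp_truncate {k : ℕ} {g : JetBundle n m k → ℝ}
    (hg : ContDiff ℝ ∞ g) (p v : Jet n m) :
    lineDeriv ℝ (fun p : Jet n m => g (p.truncate k)) p v =
      fderiv ℝ g (p.truncate k) (v.truncate k) :=
  (hasLineDerivAt_comp_truncate hg p v).lineDeriv

theorem IsLocalOfOrder.partialJet_eq_zero {k : ℕ} {f : Jet n m → ℝ} (hf : IsLocalOfOrder k f)
    (i : Fin m) {α : MultiIndex n} (hα : k < α.len) : partialJet i α f = 0 := by
  obtain ⟨g, hg, hfg⟩ := hf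
  obtain rfl : f = fun p => g (p.truncate k) := funext hfg
  funext p
  have : Jet.truncate k ((0, Pi.single (i, α) 1) : Jet n m) = 0 := by
    refine Prod.ext rfl (funext fun a => ?_)
    refine Pi.single_eq_of_ne (fun h => ?_) _
    have h2 : a.2.1 = α := congrArg Prod.snd h
    have := a.2.2
    rw [h2] at this
    omega
  rw [partialJet, lineDeriv_comp_truncate hg, this, map_zero]
  rfl

theorem IsLocalOfOrder.lineDeriv_eq_sum {k : ℕ} {f : Jet n m → ℝ} (hf : IsLocalOfOrder k f)
    (p v : Jet n m) :
    lineDeriv ℝ f p v = lineDeriv ℝ f p (v.1, 0) +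
      ∑ a : Fin m × MultiIndexLE n k, v.2 (a.1, a.2.1) * partialJet a.1 a.2.1 f p := by
  obtain ⟨g, hg, hfg⟩ := hf
  obtain rfl : f = fun p => g (p.truncate k) := funext hfg
  simp only [partialJet, lineDeriv_comp_truncate hg, ← smul_eq_mul, ← map_smul, ← map_sum,
    ← map_add]
  congr 1
  classical
  refine Prod.ext ?_ (funext fun b => ?_)
  · simp [Jet.truncate, Prod.fst_sum]
  · simp only [Jet.truncate, Prod.snd_add, Prod.snd_sum, Prod.smul_snd, Pi.add_apply,
      Finset.sum_apply, Pi.smul_apply, smul_eq_mul, Pi.zero_apply, zero_add]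
    rw [Finset.sum_eq_single b]
    · simp
    · intro a _ hab
      rw [Pi.single_eq_of_ne, mul_zero]
      intro h
      exact hab (Prod.ext (congrArg Prod.fst h).symm (Subtype.ext (congrArg Prod.snd h).symm))
    · simp

/-- The vector on jet space along which the total derivative differentiates. -/
noncomputable def totalVec (ν : Fin n) (p : Jet n m) : Jet n m :=
  (Pi.single ν 1, fun a => p.2 (a.1, a.2 + Pi.single ν 1))

theorem sum_subtype_eq_finsum {k : ℕ} {c : Fin m × MultiIndex n → ℝ}
    (hc : ∀ a, k < a.2.len → c a = 0) :
    ∑ᶠ a, c a = ∑ a : Fin m × MultiIndexLE n k, c (a.1, a.2.1) := by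
  classical
  let e : (Fin m × MultiIndexLE n k) ↪ Fin m × MultiIndex n :=
    ⟨fun a => (a.1, a.2.1), fun a b h =>
      Prod.ext (Prod.ext_iff.1 h).1 (Subtype.ext (Prod.ext_iff.1 h).2)⟩
  rw [finsum_eq_sum_of_support_subset (s := Finset.univ.map e), Finset.sum_map]
  · rfl
  · intro a ha
    have : a.2.len ≤ k := by
      by_contra h
      exact ha (hc a (not_le.1 h))
    exact Finset.mem_coe.2 (Finset.mem_map.2 ⟨(a.1, ⟨a.2, this⟩), Finset.mem_univ _, rfl⟩)

/-- With the total derivative seen as differentiation along the field `totalVec ν`, additivity, the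
Leibniz rule and the chain rule become one-variable facts. -/
theorem totalDeriv_eq_lineDeriv (ν : Fin n) {f : Jet n m → ℝ} (hf : IsLocal f) :
    totalDeriv ν f = fun p => lineDeriv ℝ f p (totalVec ν p) := by
  obtain ⟨k, hf⟩ := hf
  have hf : IsLocalOfOrder k f := hf
  funext p
  rw [hf.lineDeriv_eq_sum, totalDeriv, partialX, sum_subtype_eq_finsum (k := k)]
  · rfl
  · intro a ha
    rw [hf.partialJet_eq_zero _ ha]
    simp

/-- The order may rise from `k` to `K` because the direction may involve higher jet coordinates: `K
= k + 1` for total derivatives, `K = k` for a fixed direction. -/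
theorem IsLocal.lineDeriv {f : Jet n m → ℝ} (hf : IsLocal f) {w : Jet n m → Jet n m}
    (hw : ∀ k, ∃ K, k ≤ K ∧ ∃ W : JetBundle n m K → JetBundle n m k, ContDiff ℝ ∞ W ∧
      ∀ p, (w p).truncate k = W (p.truncate K)) :
    IsLocal (fun p => lineDeriv ℝ f p (w p)) := by
  obtain ⟨k, hf⟩ := hf
  obtain ⟨K, hkK, W, hW, hwW⟩ := hw k
  obtain ⟨g, hg, hfg⟩ := hf
  obtain rfl : f = fun p => g (p.truncate k) := funext hfg
  refine ⟨K, fun q => fderiv ℝ g (q.1, fun a => q.2 (a.1, ⟨a.2.1, a.2.2.trans hkK⟩)) (W q),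
    ContDiff.clm_apply ((hg.fderiv_right (m := ∞) (by simp)).comp (by fun_prop)) hW,
    fun p => ?_⟩
  simp only [lineDeriv_comp_truncate hg, hwW]
  rfl

theorem IsLocal.partialJet (i : Fin m) (α : MultiIndex n) {f : Jet n m → ℝ} (hf : IsLocal f) :
    IsLocal (partialJet i α f) :=
  hf.lineDeriv fun k => ⟨k, le_rfl, fun _ => Jet.truncate k (0, Pi.single (i, α) 1),
    contDiff_const, fun _ => rfl⟩

theorem len_add_single (α : MultiIndex n) (ν : Fin n) : (α + Pi.single ν 1).len = α.len + 1 := by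
  simp [MultiIndex.len, Finset.sum_add_distrib]

theorem IsLocal.totalDeriv (ν : Fin n) (f : Jet n m → ℝ) (hf : IsLocal f) :
    IsLocal (totalDeriv ν f) := by
  rw [totalDeriv_eq_lineDeriv ν hf]
  refine hf.lineDeriv fun k => ⟨k + 1, k.le_succ, fun q => (Pi.single ν 1, fun a =>
    q.2 (a.1, ⟨a.2.1 + Pi.single ν 1, by rw [len_add_single]; exact Nat.succ_le_succ a.2.2⟩)),
    by fun_prop, fun p => rfl⟩

theorem IsLocal.multiOp_totalDeriv (α : MultiIndex n) {f : Jet n m → ℝ} (hf : IsLocal f) :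
    IsLocal (multiOp LocalFunctionals.totalDeriv α f) :=
  multiOp_invariant IsLocal.totalDeriv α hf

theorem totalDeriv_zero (ν : Fin n) : totalDeriv ν (0 : Jet n m → ℝ) = 0 := by
  refine (totalDeriv_eq_lineDeriv ν (IsLocal.const 0)).trans ?_
  funext p
  simp [lineDeriv]

theorem totalDeriv_add (ν : Fin n) {f g : Jet n m → ℝ} (hf : IsLocal f) (hg : IsLocal g) :
    totalDeriv ν (fun p => f p + g p) = fun p => totalDeriv ν f p + totalDeriv ν g p := by
  rw [totalDeriv_eq_lineDeriv ν hf, totalDeriv_eq_lineDeriv ν hg,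
    totalDeriv_eq_lineDeriv ν (hf.add hg)]
  funext p
  exact (HasDerivAt.add (hf.hasLineDerivAt p (totalVec ν p))
    (hg.hasLineDerivAt p (totalVec ν p))).deriv

theorem totalDeriv_mul (ν : Fin n) {f g : Jet n m → ℝ} (hf : IsLocal f) (hg : IsLocal g) :
    totalDeriv ν (fun p => f p * g p) =
      fun p => totalDeriv ν f p * g p + f p * totalDeriv ν g p := by
  rw [totalDeriv_eq_lineDeriv ν hf, totalDeriv_eq_lineDeriv ν hg,
    totalDeriv_eq_lineDeriv ν (hf.mul hg)]
  funext p
  have h : HasDerivAt (fun t : ℝ => f (p + t • totalVec ν p) * g (p + t • totalVec ν p)) _ 0 :=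
    HasDerivAt.mul (hf.hasLineDerivAt p (totalVec ν p)) (hg.hasLineDerivAt p (totalVec ν p))
  simp only [zero_smul, add_zero] at h
  exact h.deriv

theorem totalDeriv_const_mul (ν : Fin n) (c : ℝ) {f : Jet n m → ℝ} (hf : IsLocal f) :
    totalDeriv ν (fun p => c * f p) = fun p => c * totalDeriv ν f p := by
  rw [totalDeriv_mul ν (IsLocal.const c) hf, totalDeriv_eq_lineDeriv ν (IsLocal.const c)]
  funext p
  simp [lineDeriv]

theorem totalDeriv_coord (ν : Fin n) (a : Fin m × MultiIndex n) :
    totalDeriv ν (fun p : Jet n m => p.2 a) = fun p => p.2 (a.1, a.2 + Pi.single ν 1) := by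
  rw [totalDeriv_eq_lineDeriv ν (IsLocal.coord a)]
  funext p
  have h : HasDerivAt (fun t : ℝ => p.2 a + t * p.2 (a.1, a.2 + Pi.single ν 1))
    (1 * p.2 (a.1, a.2 + Pi.single ν 1)) 0 := ((hasDerivAt_id (0 : ℝ)).mul_const _).const_add _
  rw [one_mul] at h
  exact h.deriv

theorem multiOp_totalDeriv_zero (α : MultiIndex n) :
    multiOp totalDeriv α (0 : Jet n m → ℝ) = 0 :=
  multiOp_invariant (C := fun h => h = 0) (fun μ h hh => by rw [hh, totalDeriv_zero]) α rfl

theorem IsLocalOfOrder.eulerLagrange_eq_sum {k : ℕ} {f : Jet n m → ℝ} (hf : IsLocalOfOrder k f)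
    (i : Fin m) (p : Jet n m) : eulerLagrange i f p =
      ∑ α : MultiIndexLE n k,
        (-1 : ℝ) ^ α.1.len * multiOp totalDeriv α.1 (partialJet i α.1 f) p := by
  classical
  rw [eulerLagrange, finsum_eq_sum_of_support_subset
    (s := Finset.univ.map (Function.Embedding.subtype fun α : MultiIndex n => α.len ≤ k)),
    Finset.sum_map]
  · rfl
  · intro α hα
    have : α.len ≤ k := by
      by_contra h
      refine hα ?_
      simp only
      rw [hf.partialJet_eq_zero i (not_le.1 h), multiOp_totalDeriv_zero]
      simp
    exact Finset.mem_coe.2 (Finset.mem_map.2 ⟨⟨α, this⟩, Finset.mem_univ _, rfl⟩)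

theorem IsLocal.eulerLagrange (i : Fin m) {f : Jet n m → ℝ} (hf : IsLocal f) :
    IsLocal (eulerLagrange i f) := by
  obtain ⟨k, hk⟩ := id hf
  have hk : IsLocalOfOrder k f := hk
  rw [funext (hk.eulerLagrange_eq_sum i)]
  exact IsLocal.sum _ fun α _ => ((hf.partialJet i α.1).multiOp_totalDeriv α.1).const_mul _

end Local

/-! ### Restriction to prolongations of fields -/

section Prolong

variable {n m : ℕ}

/-- Moving the base point moves the prolonged jet along `totalVec`, because ∂_ν ∂^α φ = ∂^(α + e_ν)
φ. -/
theorem hasLineDerivAt_truncate_prolong {φ : (Fin n → ℝ) → (Fin m → ℝ)} (hφ : ContDiff ℝ ∞ φ) (k : ℕ)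
    (ν : Fin n) (x : Fin n → ℝ) :
    HasLineDerivAt ℝ (fun x => (prolong φ x).truncate k)
      ((totalVec ν (prolong φ x)).truncate k) x (Pi.single ν 1) := by
  have hc : ∀ i, ContDiff ℝ ∞ fun y => φ y i := fun i => contDiff_pi.1 hφ i
  refine HasDerivAt.prodMk ?_ (hasDerivAt_pi.2 fun a => ?_)
  · exact (hasFDerivAt_id x).hasLineDerivAt (Pi.single ν 1)
  · have h := contDiff_multiOp_basePartial a.2.1 (hc a.1)
    have h2 := ((h.differentiable (by simp)) x).lineDifferentiableAt (v := Pi.single ν 1)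
      |>.hasLineDerivAt
    have h3 : lineDeriv ℝ (multiOp basePartial a.2.1 fun y => φ y a.1) x (Pi.single ν 1) =
        ((totalVec ν (prolong φ x)).truncate k).2 a :=
      congrFun (basePartial_multiOp ν a.2.1 (hc a.1)) x
    rw [h3] at h2
    exact h2

theorem contDiff_truncate_prolong {φ : (Fin n → ℝ) → (Fin m → ℝ)} (hφ : ContDiff ℝ ∞ φ) (k : ℕ) :
    ContDiff ℝ ∞ fun x => (prolong φ x).truncate k :=
  contDiff_id.prodMk (contDiff_pi.2 fun a =>
    contDiff_multiOp_basePartial a.2.1 (contDiff_pi.1 hφ a.1))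

theorem IsLocal.contDiff_comp_prolong {f : Jet n m → ℝ} (hf : IsLocal f)
    {φ : (Fin n → ℝ) → (Fin m → ℝ)} (hφ : ContDiff ℝ ∞ φ) :
    ContDiff ℝ ∞ fun x => f (prolong φ x) := by
  obtain ⟨k, g, hg, hfg⟩ := hf
  simp only [hfg]
  exact hg.comp (contDiff_truncate_prolong hφ k)

theorem totalDeriv_comp_prolong {f : Jet n m → ℝ} (hf : IsLocal f)
    {φ : (Fin n → ℝ) → (Fin m → ℝ)} (hφ : ContDiff ℝ ∞ φ) (ν : Fin n) :
    (fun x => totalDeriv ν f (prolong φ x)) = basePartial ν fun x => f (prolong φ x) := by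
  rw [totalDeriv_eq_lineDeriv ν hf]
  obtain ⟨k, g, hg, hfg⟩ := hf
  obtain rfl : f = fun p => g (p.truncate k) := funext hfg
  funext x
  simp only
  rw [lineDeriv_comp_truncate hg, basePartial]
  have h := (hg.differentiable (by simp) ((prolong φ x).truncate k)).hasFDerivAt
  have h2 := hasLineDerivAt_truncate_prolong hφ k ν x
  have h3 : HasDerivAt (fun t : ℝ => g ((prolong φ (x + t • Pi.single ν 1)).truncate k))
      (fderiv ℝ g ((prolong φ x).truncate k) ((totalVec ν (prolong φ x)).truncate k)) 0 := by
    refine HasFDerivAt.comp_hasDerivAt (f := fun t : ℝ =>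
      (prolong φ (x + t • Pi.single ν 1)).truncate k) 0 ?_ h2
    simpa using h
  exact h3.deriv.symm

theorem multiOp_totalDeriv_comp_prolong {f : Jet n m → ℝ} (hf : IsLocal f)
    {φ : (Fin n → ℝ) → (Fin m → ℝ)} (hφ : ContDiff ℝ ∞ φ) (α : MultiIndex n) :
    (fun x => multiOp totalDeriv α f (prolong φ x)) =
      multiOp basePartial α fun x => f (prolong φ x) :=
  multiOp_intertwine (Φ := fun f x => f (prolong φ x)) IsLocal.totalDeriv
    (fun ν _ hf => totalDeriv_comp_prolong hf hφ ν) α hf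

theorem prolong_eq_of_notMem_tsupport {φ : (Fin n → ℝ) → (Fin m → ℝ)} {x : Fin n → ℝ}
    (hx : x ∉ tsupport φ) : prolong φ x = (x, 0) := by
  refine Prod.ext rfl (funext fun a => ?_)
  exact multiOp_basePartial_eq_zero (isClosed_tsupport φ).isOpen_compl
    (fun y hy => by simp [image_eq_zero_of_notMem_tsupport hy]) a.2 x hx

theorem hasCompactSupport_comp_prolong {f : Jet n m → ℝ} (hf : NoFieldIndependentPart f)
    {φ : (Fin n → ℝ) → (Fin m → ℝ)} (hφ : HasCompactSupport φ) :
    HasCompactSupport fun x => f (prolong φ x) :=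
  HasCompactSupport.intro hφ fun x hx => by rw [prolong_eq_of_notMem_tsupport hx, hf]

theorem localFunctional_eq_of_differByTotalDivergence {f g : Jet n m → ℝ} (hg : IsLocal g)
    (hg₀ : NoFieldIndependentPart g) (h : DifferByTotalDivergence f g)
    {φ : (Fin n → ℝ) → (Fin m → ℝ)} (hφ : ContDiff ℝ ∞ φ) (hc : HasCompactSupport φ) :
    localFunctional f φ = localFunctional g φ := by
  obtain ⟨j, hj, hfg⟩ := h
  have hd : ∀ μ, ContDiff ℝ ∞ fun x => j μ (prolong φ x) :=
    fun μ => (hj μ).1.contDiff_comp_prolong hφ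
  have hs : ∀ μ, HasCompactSupport fun x => j μ (prolong φ x) :=
    fun μ => hasCompactSupport_comp_prolong (hj μ).2 hc
  have hi : ∀ μ, Integrable (basePartial μ fun x => j μ (prolong φ x)) := fun μ => by
    refine (contDiff_basePartial μ _ (hd μ)).continuous.integrable_of_hasCompactSupport ?_
    have := hasCompactSupport_multiOp_basePartial (Pi.single μ 1) (hs μ)
    rwa [← zero_add (Pi.single μ 1), ← basePartial_multiOp μ 0 (hd μ), multiOp_zero] at this
  have hgi : Integrable fun x => g (prolong φ x) :=
    (hg.contDiff_comp_prolong hφ).continuous.integrable_of_hasCompactSupport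
      (hasCompactSupport_comp_prolong hg₀ hc)
  have he : (fun x => f (prolong φ x)) =
      fun x => g (prolong φ x) + ∑ μ, basePartial μ (fun x => j μ (prolong φ x)) x := by
    funext x
    rw [hfg]
    congr 1
    exact Finset.sum_congr rfl fun μ _ => congrFun (totalDeriv_comp_prolong (hj μ).1 hφ μ) x
  rw [localFunctional, localFunctional, he,
    integral_add hgi (integrable_finsetSum _ fun μ _ => hi μ),
    integral_finsetSum _ fun μ _ => hi μ]
  simp [integral_basePartial_eq_zero (hd _) (hs _)]

end Prolong

/-! ### Realizing jets by compactly supported fields -/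

section Realize

variable {n m : ℕ}

theorem MultiIndex.induction {P : MultiIndex n → Prop} (h0 : P 0)
    (hs : ∀ α μ, P α → P (α + Pi.single μ 1)) (α : MultiIndex n) : P α := by
  induction hN : α.len generalizing α with
  | zero =>
    have : α = 0 := funext fun μ => by
      simpa using (Finset.sum_eq_zero_iff.1 hN) μ (Finset.mem_univ μ)
    rwa [this]
  | succ N ih =>
    have : ∃ μ, α μ ≠ 0 := by
      by_contra! h
      simp [MultiIndex.len, h] at hN
    obtain ⟨μ, hμ⟩ := this
    have hα : α = (α - Pi.single μ 1) + Pi.single μ 1 := by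
      funext ν
      by_cases h : ν = μ
      · subst h
        simp
        omega
      · simp [Pi.single_eq_of_ne h]
    rw [hα] at hN ⊢
    rw [len_add_single] at hN
    exact hs _ _ (ih _ (by omega))

theorem iteratedDeriv_sub_pow (x₀ : ℝ) (a b : ℕ) :
    iteratedDeriv b (fun t : ℝ => (t - x₀) ^ a) =
      fun t => (a.descFactorial b : ℝ) * (t - x₀) ^ (a - b) := by
  induction b with
  | zero => simp
  | succ b ih =>
    rw [iteratedDeriv_succ, ih]
    funext t
    have h : HasDerivAt (fun t : ℝ => (a.descFactorial b : ℝ) * (t - x₀) ^ (a - b))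
      ((a.descFactorial b : ℝ) * (((a - b : ℕ) : ℝ) * (t - x₀) ^ (a - b - 1) * 1)) t :=
      (((hasDerivAt_id t).sub_const x₀).pow (a - b)).const_mul _
    rw [h.deriv, Nat.descFactorial_succ, Nat.sub_sub]
    push_cast
    ring

/-- Take (t - x₀)^a / a! times a cutoff equal to 1 near x₀; derivatives at x₀ see only the monomial.
-/
theorem exists_bump_with_derivs (x₀ : ℝ) (a : ℕ) :
    ∃ h : ℝ → ℝ, ContDiff ℝ ∞ h ∧ (∀ t, t ∉ Metric.closedBall x₀ 2 → h t = 0) ∧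
      ∀ b, iteratedDeriv b h x₀ = if b = a then 1 else 0 := by
  let χ : ContDiffBump x₀ := ⟨1, 2, one_pos, one_lt_two⟩
  refine ⟨fun t => χ t * ((a.factorial : ℝ)⁻¹ * (t - x₀) ^ a), ?_, ?_, ?_⟩
  · exact χ.contDiff.mul (by fun_prop)
  · intro t ht
    have : χ t = 0 := χ.zero_of_le_dist (by
      rw [Metric.mem_closedBall, not_le] at ht
      exact ht.le)
    simp [this]
  · intro b
    have he : (fun t => χ t * ((a.factorial : ℝ)⁻¹ * (t - x₀) ^ a)) =ᶠ[𝓝 x₀]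
        fun t => (a.factorial : ℝ)⁻¹ * (t - x₀) ^ a := by
      filter_upwards [χ.eventuallyEq_one] with t ht
      rw [ht]
      simp
    rw [he.iteratedDeriv_eq, iteratedDeriv_const_mul_field, iteratedDeriv_sub_pow]
    have hf : (a.factorial : ℝ) ≠ 0 := by exact_mod_cast a.factorial_ne_zero
    -- For b < a a positive power of t - x₀ survives and vanishes at x₀; for b > a the falling
    -- factorial is zero.
    rcases lt_trichotomy b a with h | h | h
    · have : a - b ≠ 0 := by omega
      simp [this, h.ne]
    · subst h
      simp [Nat.descFactorial_self, hf]
    · simp [Nat.descFactorial_of_lt h, h.ne']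

theorem contDiff_prod_apply {h : Fin n → ℝ → ℝ} (hh : ∀ ν, ContDiff ℝ ∞ (h ν)) :
    ContDiff ℝ ∞ fun y : Fin n → ℝ => ∏ ν, h ν (y ν) :=
  contDiff_prod fun ν _ => (hh ν).comp (contDiff_apply ℝ ℝ ν)

theorem multiOp_basePartial_prod {h : Fin n → ℝ → ℝ} (hh : ∀ ν, ContDiff ℝ ∞ (h ν))
    (α : MultiIndex n) : multiOp basePartial α (fun y : Fin n → ℝ => ∏ ν, h ν (y ν)) =
      fun y => ∏ ν, iteratedDeriv (α ν) (h ν) (y ν) := by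
  induction α using MultiIndex.induction with
  | h0 => rw [multiOp_zero]; simp
  | hs α μ ih =>
    rw [← basePartial_multiOp μ α (contDiff_prod_apply hh), ih]
    funext y
    have hd : HasDerivAt (iteratedDeriv (α μ) (h μ)) (iteratedDeriv (α μ + 1) (h μ) (y μ))
        (y μ) := by
      rw [iteratedDeriv_succ]
      refine DifferentiableAt.hasDerivAt ?_
      exact ((hh μ).differentiable_iteratedDeriv (α μ) (by exact_mod_cast WithTop.coe_lt_top _)) _
    have hl : HasDerivAt (fun t : ℝ => ∏ ν, iteratedDeriv (α ν) (h ν)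
        ((y + t • (Pi.single μ 1 : Fin n → ℝ)) ν))
        (∏ ν, iteratedDeriv ((α + Pi.single μ 1 : MultiIndex n) ν) (h ν) (y ν)) 0 := by
      have e1 : ∀ t : ℝ, ∏ ν, iteratedDeriv (α ν) (h ν)
          ((y + t • (Pi.single μ 1 : Fin n → ℝ)) ν) = iteratedDeriv (α μ) (h μ) (y μ + t) *
            ∏ ν ∈ Finset.univ.erase μ, iteratedDeriv (α ν) (h ν) (y ν) := by
        intro t
        rw [← Finset.mul_prod_erase _ _ (Finset.mem_univ μ)]
        congr 1
        · simp
        · refine Finset.prod_congr rfl fun ν hν => ?_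
          simp [Pi.single_eq_of_ne (Finset.ne_of_mem_erase hν)]
      have e2 : ∏ ν, iteratedDeriv ((α + Pi.single μ 1 : MultiIndex n) ν) (h ν) (y ν) =
          iteratedDeriv (α μ + 1) (h μ) (y μ) *
            ∏ ν ∈ Finset.univ.erase μ, iteratedDeriv (α ν) (h ν) (y ν) := by
        rw [← Finset.mul_prod_erase _ _ (Finset.mem_univ μ)]
        congr 1
        · simp
        · refine Finset.prod_congr rfl fun ν hν => ?_
          simp [Pi.single_eq_of_ne (Finset.ne_of_mem_erase hν)]
      rw [funext e1, e2]
      refine HasDerivAt.mul_const ?_ _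
      exact HasDerivAt.comp_const_add (y μ) 0 (by simpa using hd)
    exact hl.deriv

theorem multiOp_basePartial_sum {ι : Type} (s : Finset ι) (c : ι → ℝ)
    {u : ι → (Fin n → ℝ) → ℝ} (hu : ∀ a, ContDiff ℝ ∞ (u a)) (α : MultiIndex n) :
    multiOp basePartial α (fun y => ∑ a ∈ s, c a * u a y) =
      fun y => ∑ a ∈ s, c a * multiOp basePartial α (u a) y := by
  have hs : ∀ {u : ι → (Fin n → ℝ) → ℝ}, (∀ a, ContDiff ℝ ∞ (u a)) →
      ContDiff ℝ ∞ fun y => ∑ a ∈ s, c a * u a y :=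
    fun hu => ContDiff.sum fun a _ => contDiff_const.mul (hu a)
  induction α using MultiIndex.induction with
  | h0 => simp [multiOp_zero]
  | hs α μ ih =>
    have hm : ∀ a, ContDiff ℝ ∞ (multiOp basePartial α (u a)) :=
      fun a => contDiff_multiOp_basePartial α (hu a)
    rw [← basePartial_multiOp μ α (hs hu), ih, basePartial_eq_fderiv (hs hm)]
    funext y
    have hd : ∀ a, DifferentiableAt ℝ (multiOp basePartial α (u a)) y :=
      fun a => (hm a).differentiable (by simp) y
    rw [fderiv_fun_sum fun a _ => (hd a).const_mul _, sum_apply]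
    refine Finset.sum_congr rfl fun a _ => ?_
    rw [fderiv_const_mul (hd a), ← basePartial_multiOp μ α (hu a), basePartial_eq_fderiv (hm a)]
    rfl

/-- Every jet of finite order is the jet of a compactly supported field configuration. -/
theorem exists_prolong_truncate_eq (k : ℕ) (p : Jet n m) :
    ∃ φ : (Fin n → ℝ) → (Fin m → ℝ), ContDiff ℝ ∞ φ ∧ HasCompactSupport φ ∧
      (prolong φ p.1).truncate k = p.truncate k := by
  choose h hsm hsupp hder using exists_bump_with_derivs
  have hpr : ∀ α : MultiIndexLE n k,
      ContDiff ℝ ∞ fun y : Fin n → ℝ => ∏ ν, h (p.1 ν) (α.1 ν) (y ν) :=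
    fun α => contDiff_prod_apply fun ν => hsm _ _
  -- The products of one-variable bumps are dual to the partial derivatives at `p.1`, so the
  -- prescribed jet coordinates are the coefficients.
  let φ : (Fin n → ℝ) → (Fin m → ℝ) := fun y i =>
    ∑ α : MultiIndexLE n k, p.2 (i, α.1) * ∏ ν, h (p.1 ν) (α.1 ν) (y ν)
  refine ⟨φ, ?_, ?_, ?_⟩
  · exact contDiff_pi.2 fun i => ContDiff.sum fun α _ => contDiff_const.mul (hpr α)
  · refine HasCompactSupport.intro
      (isCompact_univ_pi fun ν => isCompact_closedBall (p.1 ν) 2) fun y hy => ?_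
    rw [Set.mem_univ_pi] at hy
    push Not at hy
    obtain ⟨ν, hν⟩ := hy
    funext i
    refine Finset.sum_eq_zero fun α _ => ?_
    rw [Finset.prod_eq_zero (Finset.mem_univ ν) (hsupp _ _ _ hν), mul_zero]
  · refine Prod.ext rfl (funext fun b => ?_)
    have e : multiOp basePartial b.2.1 (fun y => φ y b.1) p.1 =
        ∑ α : MultiIndexLE n k, p.2 (b.1, α.1) *
          ∏ ν, iteratedDeriv (b.2.1 ν) (h (p.1 ν) (α.1 ν)) (p.1 ν) := by
      rw [multiOp_basePartial_sum Finset.univ (fun α : MultiIndexLE n k => p.2 (b.1, α.1)) hpr]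
      refine Finset.sum_congr rfl fun α _ => ?_
      rw [multiOp_basePartial_prod fun ν => hsm _ _]
    refine e.trans ?_
    rw [Finset.sum_eq_single b.2]
    · simp [hder, Jet.truncate]
    · intro α _ hα
      have : ∃ ν, b.2.1 ν ≠ α.1 ν := by
        by_contra! hc
        exact hα (Subtype.ext (funext fun ν => (hc ν).symm))
      obtain ⟨ν, hν⟩ := this
      rw [Finset.prod_eq_zero (Finset.mem_univ ν), mul_zero]
      rw [hder, if_neg hν]
    · simp

theorem IsLocal.eq_zero_of_comp_prolong {f : Jet n m → ℝ} (hf : IsLocal f)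
    (h : ∀ φ : (Fin n → ℝ) → (Fin m → ℝ), ContDiff ℝ ∞ φ → HasCompactSupport φ →
      ∀ x, f (prolong φ x) = 0) (p : Jet n m) : f p = 0 := by
  obtain ⟨k, g, hg, hfg⟩ := hf
  obtain ⟨φ, hφ, hc, he⟩ := exists_prolong_truncate_eq k p
  rw [hfg, ← he, ← hfg, h φ hφ hc]

end Realize

/-! ### First variation and the Euler–Lagrange equations -/

section Variation

variable {n m : ℕ}

theorem multiOp_basePartial_add_mul {u v : (Fin n → ℝ) → ℝ} (hu : ContDiff ℝ ∞ u)
    (hv : ContDiff ℝ ∞ v) (s : ℝ) (α : MultiIndex n) :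
    multiOp basePartial α (fun y => u y + s * v y) =
      fun y => multiOp basePartial α u y + s * multiOp basePartial α v y := by
  have h := multiOp_basePartial_sum Finset.univ ![1, s] (u := ![u, v])
    (by intro a; fin_cases a <;> assumption) α
  simpa [Fin.sum_univ_two] using h

/-- The integral is the derivative at s = 0 of F[h, φ + sψ], which is zero for all s. -/
theorem integral_variation_eq_zero {h : Jet n m → ℝ} {k : ℕ} (hh : IsLocalOfOrder k h)
    (hh₀ : NoFieldIndependentPart h)
    (hF : ∀ φ : (Fin n → ℝ) → (Fin m → ℝ), ContDiff ℝ ∞ φ → HasCompactSupport φ →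
      localFunctional h φ = 0)
    {φ ψ : (Fin n → ℝ) → (Fin m → ℝ)} (hφ : ContDiff ℝ ∞ φ) (hφc : HasCompactSupport φ)
    (hψ : ContDiff ℝ ∞ ψ) (hψc : HasCompactSupport ψ) :
    ∫ x, ∑ a : Fin m × MultiIndexLE n k,
      multiOp basePartial a.2.1 (fun y => ψ y a.1) x * partialJet a.1 a.2.1 h (prolong φ x) = 0 := by
  obtain ⟨g, hg, hhg⟩ := id hh
  -- One compact set for all s: off `K` both prolongations have zero field part, so the integrand is
  -- h[x, 0] = 0.
  set K : Set (Fin n → ℝ) := tsupport φ ∪ tsupport ψ with hK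
  have hKc : IsCompact K := IsCompact.union hφc hψc
  let W : (Fin n → ℝ) → Jet n m := fun x => (0, (prolong ψ x).2)
  have hW : ContDiff ℝ ∞ fun x => (W x).truncate k :=
    contDiff_const.prodMk (contDiff_pi.2 fun a =>
      contDiff_multiOp_basePartial a.2.1 (contDiff_pi.1 hψ a.1))
  have hQ := contDiff_truncate_prolong hφ k
  let G : ℝ × (Fin n → ℝ) → ℝ := fun z =>
    g ((prolong φ z.2).truncate k + z.1 • (W z.2).truncate k)
  have hG : ContDiff ℝ ∞ G :=
    hg.comp ((hQ.comp contDiff_snd).add (contDiff_fst.smul (hW.comp contDiff_snd)))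
  have hprol : ∀ (s : ℝ) x, prolong (fun y => φ y + s • ψ y) x = prolong φ x + s • W x := by
    intro s x
    refine Prod.ext (by simp [prolong, W]) (funext fun a => ?_)
    exact congrFun (multiOp_basePartial_add_mul (contDiff_pi.1 hφ a.1) (contDiff_pi.1 hψ a.1)
      s a.2) x
  have hint : ∀ s : ℝ, ∫ x in K, G (s, x) = 0 := by
    intro s
    have e : ∀ x, G (s, x) = h (prolong (fun y => φ y + s • ψ y) x) := fun x => by
      rw [hprol, hhg]
      rfl
    rw [setIntegral_eq_integral_of_forall_compl_eq_zero]
    · simp only [e]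
      exact hF _ (hφ.add (hψ.const_smul s)) (hφc.add (hψc.smul_left (f := fun _ => s)))
    · intro x hx
      have hx' : x ∉ tsupport φ ∧ x ∉ tsupport ψ := not_or.1 hx
      have hz : W x = 0 := by
        simp only [W, prolong_eq_of_notMem_tsupport hx'.2]
        rfl
      rw [e, hprol, hz, smul_zero, add_zero, prolong_eq_of_notMem_tsupport hx'.1, hh₀]
  have hder := hasFDerivAt_setIntegral_of_contDiff (hG.of_le (by exact_mod_cast le_top)) hKc
    (volume : Measure (Fin n → ℝ)) 0
  simp only [hint] at hder
  have hzero := hder.unique (hasFDerivAt_const (0 : ℝ) (0 : ℝ))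
  have hcont : Continuous fun x : Fin n → ℝ =>
      (fderiv ℝ G (0, x)).comp (ContinuousLinearMap.inl ℝ ℝ (Fin n → ℝ)) :=
    ((hG.continuous_fderiv (by simp)).comp (by fun_prop)).clm_comp continuous_const
  have happ := congrArg (fun L : ℝ →L[ℝ] ℝ => L 1) hzero
  rw [ContinuousLinearMap.integral_apply (hcont.continuousOn.integrableOn_compact hKc)] at happ
  have hval : ∀ x, ((fderiv ℝ G (0, x)).comp (ContinuousLinearMap.inl ℝ ℝ (Fin n → ℝ))) 1 =
      ∑ a : Fin m × MultiIndexLE n k, multiOp basePartial a.2.1 (fun y => ψ y a.1) x *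
        partialJet a.1 a.2.1 h (prolong φ x) := by
    intro x
    have h1 : lineDeriv ℝ h (prolong φ x) (W x) = ∑ a : Fin m × MultiIndexLE n k,
        multiOp basePartial a.2.1 (fun y => ψ y a.1) x *
        partialJet a.1 a.2.1 h (prolong φ x) := by
      rw [hh.lineDeriv_eq_sum]
      have : lineDeriv ℝ h (prolong φ x) ((W x).1, 0) = 0 := lineDeriv_zero
      rw [this, zero_add]
      rfl
    rw [← h1, lineDeriv]
    have h2 : HasLineDerivAt ℝ G (fderiv ℝ G (0, x) (1, 0)) (0, x) (1, 0) :=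
      (hG.differentiable (by simp) (0, x)).hasFDerivAt.hasLineDerivAt _
    have h3 : (fun t : ℝ => G ((0, x) + t • (1, 0))) = fun t : ℝ => h (prolong φ x + t • W x) := by
      funext t
      rw [hhg]
      simp only [G, Prod.smul_mk, Prod.mk_add_mk, smul_zero, add_zero, zero_add, smul_eq_mul,
        mul_one]
      rfl
    rw [← h3]
    exact h2.deriv.symm
  simp only [hval] at happ
  rw [setIntegral_eq_integral_of_forall_compl_eq_zero] at happ
  · exact happ
  · intro x hx
    have hx' : x ∉ tsupport φ ∧ x ∉ tsupport ψ := not_or.1 hx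
    refine Finset.sum_eq_zero fun a _ => ?_
    have := congrFun (congrArg Prod.snd (prolong_eq_of_notMem_tsupport hx'.2)) (a.1, a.2.1)
    have h0 : multiOp basePartial a.2.1 (fun y => ψ y a.1) x = 0 := this
    rw [h0, zero_mul]

theorem eulerLagrange_eq_zero_of_localFunctional {h : Jet n m → ℝ} (hh : IsLocal h)
    (hh₀ : NoFieldIndependentPart h)
    (hF : ∀ φ : (Fin n → ℝ) → (Fin m → ℝ), ContDiff ℝ ∞ φ → HasCompactSupport φ →
      localFunctional h φ = 0) (i : Fin m) (p : Jet n m) : eulerLagrange i h p = 0 := by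
  refine (hh.eulerLagrange i).eq_zero_of_comp_prolong (fun φ hφ hφc => ?_) p
  have hEc : ContDiff ℝ ∞ fun x => eulerLagrange i h (prolong φ x) :=
    (hh.eulerLagrange i).contDiff_comp_prolong hφ
  obtain ⟨k, hk⟩ := id hh
  have hk : IsLocalOfOrder k h := hk
  have hae : ∀ᵐ x, eulerLagrange i h (prolong φ x) = 0 := by
    refine ae_eq_zero_of_integral_contDiff_smul_eq_zero hEc.continuous.locallyIntegrable ?_
    intro ρ hρ hρc
    -- Varying only the `i`-th field isolates the `i`-th Euler–Lagrange derivative.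
    let ψ : (Fin n → ℝ) → (Fin m → ℝ) := fun y => Pi.single i (ρ y)
    have hψ : ContDiff ℝ ∞ ψ :=
      (ContinuousLinearMap.single ℝ (fun _ : Fin m => ℝ) i).contDiff.comp hρ
    have hψc : HasCompactSupport ψ := HasCompactSupport.intro hρc fun x hx => by
      simp [ψ, image_eq_zero_of_notMem_tsupport hx]
    have hv := integral_variation_eq_zero hk hh₀ hF hφ hφc hψ hψc
    have hA : ∀ α, ContDiff ℝ ∞ fun x => partialJet i α h (prolong φ x) :=
      fun α => (hh.partialJet i α).contDiff_comp_prolong hφ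
    have e1 : ∀ x, ∑ a : Fin m × MultiIndexLE n k, multiOp basePartial a.2.1 (fun y => ψ y a.1) x *
        partialJet a.1 a.2.1 h (prolong φ x) = ∑ α : MultiIndexLE n k,
          multiOp basePartial α.1 ρ x * partialJet i α.1 h (prolong φ x) := by
      intro x
      rw [Fintype.sum_prod_type, Finset.sum_eq_single i]
      · simp [ψ]
      · intro j _ hj
        refine Finset.sum_eq_zero fun α _ => ?_
        rw [multiOp_basePartial_eq_zero isOpen_univ (fun y _ => ?_) α.1 x (Set.mem_univ x),
          zero_mul]
        simp [ψ, Pi.single_eq_of_ne hj]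
      · simp
    have hi1 : ∀ α : MultiIndexLE n k, Integrable fun x =>
        multiOp basePartial α.1 ρ x * partialJet i α.1 h (prolong φ x) := fun α =>
      ((contDiff_multiOp_basePartial α.1 hρ).continuous.mul
        (hA α.1).continuous).integrable_of_hasCompactSupport
        (hasCompactSupport_multiOp_basePartial α.1 hρc).mul_right
    have hi2 : ∀ α : MultiIndexLE n k, Integrable fun x => (-1 : ℝ) ^ α.1.len *
        (ρ x * multiOp basePartial α.1 (fun x => partialJet i α.1 h (prolong φ x)) x) := fun α =>
      ((hρ.continuous.mul (contDiff_multiOp_basePartial α.1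
        (hA α.1)).continuous).integrable_of_hasCompactSupport hρc.mul_right).const_mul _
    simp only [e1] at hv
    rw [integral_finsetSum _ fun α _ => hi1 α] at hv
    simp only [integral_multiOp_basePartial_mul (hA _) hρ hρc, ← integral_const_mul] at hv
    rw [← integral_finsetSum _ fun α _ => hi2 α] at hv
    rw [← hv]
    congr 1
    funext x
    rw [hk.eulerLagrange_eq_sum, smul_eq_mul, Finset.mul_sum]
    refine Finset.sum_congr rfl fun α _ => ?_
    rw [← multiOp_totalDeriv_comp_prolong (hh.partialJet i α.1) hφ]
    ring
  -- Continuity upgrades almost everywhere to everywhere.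
  exact fun x => congrFun ((hEc.continuous.ae_eq_iff_eq volume continuous_const).1 hae) x

end Variation

/-! ### The homotopy formula and exactness -/

section Homotopy

variable {n m : ℕ}

/-- Average of `f` over the segment `(x, t φ)`, `0 ≤ t ≤ 1`. -/
noncomputable def fiberAverage (f : Jet n m → ℝ) : Jet n m → ℝ :=
  fun p => ∫ t in Set.Icc (0 : ℝ) 1, f (p.1, t • p.2)

theorem contDiff_scale_comp {k : ℕ} {g : JetBundle n m k → ℝ} (hg : ContDiff ℝ ∞ g) :
    ContDiff ℝ ∞ fun z : JetBundle n m k × ℝ => g (z.1.1, z.2 • z.1.2) :=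
  hg.comp (by fun_prop)

theorem IsLocal.fiberAverage {f : Jet n m → ℝ} (hf : IsLocal f) : IsLocal (fiberAverage f) := by
  obtain ⟨k, g, hg, hfg⟩ := hf
  refine ⟨k, fun q => ∫ t in Set.Icc (0 : ℝ) 1, g (q.1, t • q.2), ?_, fun p => ?_⟩
  · exact contDiff_infty.2 fun N =>
      contDiff_setIntegral isCompact_Icc volume N (contDiff_scale_comp hg)
  · simp only [LocalFunctionals.fiberAverage, hfg]
    rfl

theorem IsLocal.continuous_scale {f : Jet n m → ℝ} (hf : IsLocal f) (p : Jet n m) :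
    Continuous fun t : ℝ => f (p.1, t • p.2) := by
  obtain ⟨k, g, hg, hfg⟩ := hf
  simp only [hfg]
  exact (contDiff_scale_comp hg).continuous.comp
    (by fun_prop : Continuous fun t : ℝ => (p.truncate k, t))

theorem lineDeriv_fiberAverage {f : Jet n m → ℝ} (hf : IsLocal f) (p v : Jet n m) :
    lineDeriv ℝ (fiberAverage f) p v =
      ∫ t in Set.Icc (0 : ℝ) 1, lineDeriv ℝ f (p.1, t • p.2) (v.1, t • v.2) := by
  obtain ⟨k, g, hg, hfg⟩ := hf
  obtain rfl : f = fun p => g (p.truncate k) := funext hfg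
  have hG := contDiff_scale_comp hg
  set G : JetBundle n m k × ℝ → ℝ := fun z => g (z.1.1, z.2 • z.1.2) with hGdef
  have h := hasFDerivAt_setIntegral_of_contDiff (hG.of_le (by exact_mod_cast le_top))
    isCompact_Icc (volume : Measure ℝ) (K := Set.Icc 0 1) (p.truncate k)
  have hcont : Continuous fun t : ℝ => (fderiv ℝ G (p.truncate k, t)).comp
      (ContinuousLinearMap.inl ℝ (JetBundle n m k) ℝ) :=
    ((hG.continuous_fderiv (by simp)).comp (by fun_prop)).clm_comp continuous_const
  have h1 := (h.hasLineDerivAt (v.truncate k)).lineDeriv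
  rw [ContinuousLinearMap.integral_apply (hcont.continuousOn.integrableOn_compact isCompact_Icc)]
    at h1
  refine Eq.trans ?_ (h1.trans ?_)
  · rfl
  · congr 1
    funext t
    have h2 : HasLineDerivAt ℝ G (fderiv ℝ G (p.truncate k, t) (v.truncate k, 0))
        (p.truncate k, t) (v.truncate k, 0) :=
      (hG.differentiable (by simp) _).hasFDerivAt.hasLineDerivAt _
    refine h2.lineDeriv.symm.trans ?_
    unfold lineDeriv
    congr 1
    funext s
    simp only [hGdef, Jet.truncate]
    congr 1
    refine Prod.ext rfl (funext fun a => ?_)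
    simp [mul_add, mul_left_comm]

/-- Scaling the field coordinates by t fixes x and sends `totalVec ν` at a jet to `totalVec ν` at
the scaled jet. -/
theorem totalDeriv_fiberAverage (ν : Fin n) (f : Jet n m → ℝ) (hf : IsLocal f) :
    fiberAverage (totalDeriv ν f) = totalDeriv ν (fiberAverage f) := by
  rw [totalDeriv_eq_lineDeriv ν hf, totalDeriv_eq_lineDeriv ν hf.fiberAverage]
  funext p
  rw [lineDeriv_fiberAverage hf]
  rfl

/-- The fundamental theorem of calculus along t ↦ (x, tφ), whose value at t = 0 vanishes. -/
theorem IsLocalOfOrder.eq_sum_fiberAverage {k : ℕ} {f : Jet n m → ℝ} (hf : IsLocalOfOrder k f)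
    (hf₀ : NoFieldIndependentPart f) (p : Jet n m) :
    f p = ∑ a : Fin m × MultiIndexLE n k,
      p.2 (a.1, a.2.1) * fiberAverage (partialJet a.1 a.2.1 f) p := by
  have hl := hf.isLocal
  have hv : ∀ t : ℝ, lineDeriv ℝ f (p.1, t • p.2) (0, p.2) =
      ∑ a : Fin m × MultiIndexLE n k,
        p.2 (a.1, a.2.1) * partialJet a.1 a.2.1 f (p.1, t • p.2) := by
    intro t
    rw [hf.lineDeriv_eq_sum]
    have : lineDeriv ℝ f (p.1, t • p.2) ((0 : Fin n → ℝ), 0) = 0 := lineDeriv_zero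
    simp only [this, zero_add]
  have hc : ∀ a : Fin m × MultiIndexLE n k, Continuous fun t : ℝ =>
      p.2 (a.1, a.2.1) * partialJet a.1 a.2.1 f (p.1, t • p.2) := fun a =>
    continuous_const.mul ((hl.partialJet a.1 a.2.1).continuous_scale p)
  have hd : ∀ t : ℝ, HasDerivAt (fun t : ℝ => f (p.1, t • p.2))
      (lineDeriv ℝ f (p.1, t • p.2) (0, p.2)) t := by
    intro t
    have h := hl.hasLineDerivAt (p.1, t • p.2) (0, p.2)
    have h' : HasDerivAt (fun s : ℝ => f ((p.1, t • p.2) + s • (0, p.2)))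
        (lineDeriv ℝ f (p.1, t • p.2) (0, p.2)) (t - t) := by rw [sub_self]; exact h
    refine (h'.comp_sub_const t t).congr_of_eventuallyEq (Filter.Eventually.of_forall fun s => ?_)
    simp only [Prod.smul_mk, Prod.mk_add_mk, smul_zero, add_zero, ← add_smul, add_sub_cancel]
  have hftc := intervalIntegral.integral_eq_sub_of_hasDerivAt (a := 0) (b := 1)
    (fun t _ => hd t) (by
      simp only [hv]
      exact (continuous_finsetSum _ fun a _ => hc a).intervalIntegrable 0 1)
  rw [one_smul, zero_smul, hf₀, sub_zero, intervalIntegral.integral_of_le zero_le_one,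
    ← integral_Icc_eq_integral_Ioc] at hftc
  simp only [hv] at hftc
  rw [integral_finsetSum _ fun a _ => (hc a).continuousOn.integrableOn_compact isCompact_Icc]
    at hftc
  rw [← hftc]
  exact Finset.sum_congr rfl fun a _ => integral_const_mul _ _

/-- The total divergences of local currents without field-independent part. -/
def totalDivergences (n m : ℕ) : Submodule ℝ (Jet n m → ℝ) where
  carrier := {u | ∃ j : Fin n → Jet n m → ℝ,
    (∀ μ, IsLocal (j μ) ∧ NoFieldIndependentPart (j μ)) ∧
      ∀ p, u p = ∑ μ, totalDeriv μ (j μ) p}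
  add_mem' := by
    rintro u v ⟨j, hj, hu⟩ ⟨l, hl, hv⟩
    refine ⟨fun μ p => j μ p + l μ p, fun μ => ⟨(hj μ).1.add (hl μ).1, fun x => ?_⟩, fun p => ?_⟩
    · simp only [(hj μ).2 x, (hl μ).2 x, add_zero]
    · simp only [totalDeriv_add _ (hj _).1 (hl _).1, Finset.sum_add_distrib, Pi.add_apply, hu, hv]
  zero_mem' := by
    refine ⟨fun _ => 0, fun μ => ⟨IsLocal.const 0, fun x => rfl⟩, fun p => ?_⟩
    simp [totalDeriv_zero]
  smul_mem' := by
    rintro c u ⟨j, hj, hu⟩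
    refine ⟨fun μ p => c * j μ p, fun μ => ⟨(hj μ).1.const_mul c, fun x => ?_⟩, fun p => ?_⟩
    · simp only [(hj μ).2 x, mul_zero]
    · simp only [totalDeriv_const_mul _ _ (hj _).1, Pi.smul_apply, smul_eq_mul, hu,
        Finset.mul_sum]

theorem totalDeriv_mem_totalDivergences (ν : Fin n) {u : Jet n m → ℝ} (hu : IsLocal u)
    (hu₀ : NoFieldIndependentPart u) : totalDeriv ν u ∈ totalDivergences n m := by
  classical
  refine ⟨Pi.single ν u, fun μ => ?_, fun p => ?_⟩
  · by_cases h : μ = ν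
    · subst h
      rw [Pi.single_eq_same]
      exact ⟨hu, hu₀⟩
    · rw [Pi.single_eq_of_ne h]
      exact ⟨IsLocal.const 0, fun x => rfl⟩
  · rw [Finset.sum_eq_single ν]
    · rw [Pi.single_eq_same]
    · intro μ _ hμ
      rw [Pi.single_eq_of_ne hμ, totalDeriv_zero]
      rfl
    · simp

/-- The product `φ^i_γ h`, modulo total divergences. -/
def coordMulClass (i : Fin m) (γ : MultiIndex n) (h : Jet n m → ℝ) :
    (Jet n m → ℝ) ⧸ totalDivergences n m :=
  Submodule.Quotient.mk fun p => p.2 (i, γ) * h p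

/-- For a single index this is the Leibniz rule for ∂_ν(φ^i_γ h), the divergence of a current that
vanishes at zero field. -/
theorem coordMulClass_add (i : Fin m) (γ α : MultiIndex n) {h : Jet n m → ℝ} (hh : IsLocal h) :
    coordMulClass i (γ + α) h =
      (-1 : ℝ) ^ α.len • coordMulClass i γ (multiOp totalDeriv α h) := by
  refine multiOp_transfer IsLocal.totalDeriv (T := coordMulClass i) (fun γ ν h hh => ?_) γ α hh
  rw [eq_neg_iff_add_eq_zero, coordMulClass, coordMulClass, ← Submodule.Quotient.mk_add,
    Submodule.Quotient.mk_eq_zero]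
  have hmem := totalDeriv_mem_totalDivergences ν ((IsLocal.coord (i, γ)).mul hh)
    (fun x => zero_mul _)
  rw [totalDeriv_mul ν (IsLocal.coord (i, γ)) hh, totalDeriv_coord] at hmem
  exact hmem

theorem mem_totalDivergences_of_eulerLagrange_eq_zero {f : Jet n m → ℝ} (hf : IsLocal f)
    (hf₀ : NoFieldIndependentPart f) (hE : ∀ i p, eulerLagrange i f p = 0) :
    f ∈ totalDivergences n m := by
  obtain ⟨k, hk⟩ := id hf
  have hk : IsLocalOfOrder k f := hk
  have hA : ∀ (i : Fin m) (α : MultiIndex n), IsLocal (partialJet i α f) :=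
    fun i α => hf.partialJet i α
  have hM : ∀ (i : Fin m) (α : MultiIndex n),
      fiberAverage (multiOp totalDeriv α (partialJet i α f)) =
        multiOp totalDeriv α (fiberAverage (partialJet i α f)) := fun i α =>
    multiOp_intertwine IsLocal.totalDeriv totalDeriv_fiberAverage α (hA i α)
  -- The sum is the fibre average of the Euler–Lagrange derivative.
  have hzero : ∀ (i : Fin m) (p : Jet n m), ∑ α : MultiIndexLE n k, (-1 : ℝ) ^ α.1.len *
      multiOp totalDeriv α.1 (fiberAverage (partialJet i α.1 f)) p = 0 := by
    intro i p
    have hc : ∀ α : MultiIndexLE n k, IntegrableOn (fun t : ℝ => (-1 : ℝ) ^ α.1.len *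
        multiOp totalDeriv α.1 (partialJet i α.1 f) (p.1, t • p.2)) (Set.Icc 0 1) := fun α =>
      (continuous_const.mul (((hA i α.1).multiOp_totalDeriv α.1).continuous_scale
        p)).continuousOn.integrableOn_compact isCompact_Icc
    simp only [← hM, fiberAverage, ← integral_const_mul]
    rw [← integral_finsetSum _ fun α _ => hc α]
    simp only [← hk.eulerLagrange_eq_sum, hE, integral_zero]
  -- Writing α as `0 + α` prepares for moving all of α off the coordinate, with γ = 0.
  have hsum : f = ∑ a : Fin m × MultiIndexLE n k,
      fun p => p.2 (a.1, 0 + a.2.1) * fiberAverage (partialJet a.1 a.2.1 f) p := by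
    funext p
    rw [hk.eq_sum_fiberAverage hf₀ p, Finset.sum_apply]
    simp only [zero_add]
  rw [← Submodule.Quotient.mk_eq_zero, hsum, ← Submodule.mkQ_apply, map_sum]
  have hterm : ∀ a : Fin m × MultiIndexLE n k, (totalDivergences n m).mkQ
      (fun p => p.2 (a.1, 0 + a.2.1) * fiberAverage (partialJet a.1 a.2.1 f) p) =
      (totalDivergences n m).mkQ ((-1 : ℝ) ^ a.2.1.len • fun p : Jet n m => p.2 (a.1, 0) *
        multiOp totalDeriv a.2.1 (fiberAverage (partialJet a.1 a.2.1 f)) p) := by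
    intro a
    rw [map_smul]
    exact coordMulClass_add a.1 0 a.2.1 (hA a.1 a.2.1).fiberAverage
  rw [Finset.sum_congr rfl fun a _ => hterm a, ← map_sum]
  convert map_zero (totalDivergences n m).mkQ
  funext p
  rw [Finset.sum_apply, Fintype.sum_prod_type]
  refine Finset.sum_eq_zero fun i _ => ?_
  have h := congrArg (fun c => p.2 (i, 0) * c) (hzero i p)
  simp only [Finset.mul_sum, mul_zero] at h
  rw [← h]
  refine Finset.sum_congr rfl fun α _ => ?_
  simp only [Pi.smul_apply, smul_eq_mul]
  ring

theorem sub_mem_totalDivergences_iff {f g : Jet n m → ℝ} :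
    f - g ∈ totalDivergences n m ↔ DifferByTotalDivergence f g := by
  refine exists_congr fun j => and_congr_right fun _ => forall_congr' fun p => ?_
  rw [Pi.sub_apply, sub_eq_iff_eq_add']

end Homotopy

/-! ### Assembling the equivalences -/

theorem localFunctional_sub {n m : ℕ} {f g : Jet n m → ℝ} (hf : IsLocal f)
    (hf₀ : NoFieldIndependentPart f) (hg : IsLocal g) (hg₀ : NoFieldIndependentPart g)
    {φ : (Fin n → ℝ) → (Fin m → ℝ)} (hφ : ContDiff ℝ ∞ φ) (hc : HasCompactSupport φ) :
    localFunctional (f - g) φ = localFunctional f φ - localFunctional g φ :=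
  integral_sub
    ((hf.contDiff_comp_prolong hφ).continuous.integrable_of_hasCompactSupport
      (hasCompactSupport_comp_prolong hf₀ hc))
    ((hg.contDiff_comp_prolong hφ).continuous.integrable_of_hasCompactSupport
      (hasCompactSupport_comp_prolong hg₀ hc))

end LocalFunctionals

theorem lemma2 (n m : ℕ) (f g : LocalFunctionals.Jet n m → ℝ)
    (hf : LocalFunctionals.IsLocal f) (hf₀ : LocalFunctionals.NoFieldIndependentPart f)
    (hg : LocalFunctionals.IsLocal g) (hg₀ : LocalFunctionals.NoFieldIndependentPart g) :
    ((∀ φ : (Fin n → ℝ) → (Fin m → ℝ), ContDiff ℝ ∞ φ → HasCompactSupport φ →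
        LocalFunctionals.localFunctional f φ = LocalFunctionals.localFunctional g φ) ↔
      LocalFunctionals.DifferByTotalDivergence f g) ∧
    (LocalFunctionals.DifferByTotalDivergence f g ↔
      ∀ (i : Fin m) (p : LocalFunctionals.Jet n m),
        LocalFunctionals.eulerLagrange i (f - g) p = 0) := by
  have h₀ : LocalFunctionals.NoFieldIndependentPart (f - g) := fun x => by
    rw [Pi.sub_apply, hf₀, hg₀, sub_zero]
  have hFE : (∀ φ : (Fin n → ℝ) → (Fin m → ℝ), ContDiff ℝ ∞ φ → HasCompactSupport φ →
      LocalFunctionals.localFunctional f φ = LocalFunctionals.localFunctional g φ) →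
      ∀ (i : Fin m) (p : LocalFunctionals.Jet n m),
        LocalFunctionals.eulerLagrange i (f - g) p = 0 := fun h =>
    LocalFunctionals.eulerLagrange_eq_zero_of_localFunctional (hf.sub hg) h₀ fun φ hφ hc => by
      rw [LocalFunctionals.localFunctional_sub hf hf₀ hg hg₀ hφ hc, h φ hφ hc, sub_self]
  have hED : (∀ (i : Fin m) (p : LocalFunctionals.Jet n m),
      LocalFunctionals.eulerLagrange i (f - g) p = 0) →
      LocalFunctionals.DifferByTotalDivergence f g := fun h =>
    LocalFunctionals.sub_mem_totalDivergences_iff.1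
      (LocalFunctionals.mem_totalDivergences_of_eulerLagrange_eq_zero (hf.sub hg) h₀ h)
  have hDF : LocalFunctionals.DifferByTotalDivergence f g →
      ∀ φ : (Fin n → ℝ) → (Fin m → ℝ), ContDiff ℝ ∞ φ → HasCompactSupport φ →
      LocalFunctionals.localFunctional f φ = LocalFunctionals.localFunctional g φ :=
    fun h _ hφ hc =>
      LocalFunctionals.localFunctional_eq_of_differByTotalDivergence hg hg₀ h hφ hc
  exact ⟨⟨fun h => hED (hFE h), hDF⟩, ⟨fun h => hFE (hDF h), hED⟩⟩
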